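/- Let $d,L\ge 1$ be integers and consider a periodic chain of $2L$ qudits with sites $x\in\mathbb Z_{2L}$ and Hilbert space $(\mathbb C^d)^{\otimes 2L}$ (tensor factors ordered as sites $0,1,\dots,2L-1$). Let $U,V\in\mathrm{End}(\mathbb C^d\otimes\mathbb C^d)$ be dual-unitary gates: $U$ and $V$ are unitary, and so are $\tilde U,\tilde V$, where $\langle i|\langle j|\tilde U|k\rangle|l\rangle=\langle l|\langle j|U|k\rangle|i\rangle$. Let $\mathbb U=\Pi\,V^{\otimes L}\,\Pi^{-1}\,U^{\otimes L}$, where $\Pi|i_0\rangle|i_1\rangle\cdots|i_{2L-1}\rangle=|i_1\rangle\cdots|i_{2L-1}\rangle|i_0\rangle$; thus $U$ acts on the pairs $(2k,2k+1)$ and then $V$ on the pairs $(2k-1,2k)$. For $w\ge 1$ let $\bar{\mathcal A}_w$ be the set of operators on $(\mathbb C^d)^{\otimes w}$ whose partial traces over the first and over the last tensor factor both vanish, and let $a_{x,\dots,x+w-1}$ denote the operator acting as $a$ on the sites $x,\dots,x+w-1$ (mod $2L$) and as the identity elsewhere. Let $$\mathcal Q=\sum_{x\in\mathbb Z_{2L}}\;\sum_{1\le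 w\le L-4} q(x,w)_{x,\dots,x+w-1},\qquad q(x,w)\in\bar{\mathcal A}_w .$$ Let $\mathcal B_{\rm ee}$ (resp. $\mathcal B_{\rm oe}$) be the set of all operators $a_{x,\dots,x+w-1}$ with $a\in\bar{\mathcal A}_w$, $w$ even, $1\le w\le L$, and $x$ even (resp. $x$ odd). Then: 1. (No even-even terms.) If $\mathbb U\mathcal Q\mathbb U^\dagger=\mathcal Q$, then $\mathrm{tr}(\mathcal Q^\dagger a)=0$ for all $a\in\mathcal B_{\rm ee}$. 2. (Odd-even terms are not sufficient.) Let $A$ be the set of all operators $a_{x,\dots,x+w-1}$ with $x\in\mathbb Z_{2L}$, $1\le w\le L-4$, $a\in\bar{\mathcal A}_w$ and $\mathrm{tr}(\mathcal Q^\dagger a_{x,\dots,x+w-1})\ne 0$. If $\mathcal Q\neq 0$ and $A\subseteq\mathcal B_{\rm oe}$, then $\mathbb U\mathcal Q\mathbb U^\dagger\neq\mathcal Q$. 3. (Only odd-width terms.) If $\mathbb U\mathcal Q\mathbb U^\dagger=\mathcal Q$, then $q(x,w)=0$ for every $x\in\mathbb Z_{2L}$ and every even $w$ with $1\le w\le L-4$.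 -/

import Mathlib

namespace DUC

/-- Matrices acting on the tensor product of copies of `ℂ^d`, one copy for each site in `ι`, written
in the product basis: a basis vector is a configuration `ι → Fin d`. The algebra `𝒜_w` of width-`w`
operators is `Op d (Fin w)`, and the algebra of the periodic chain of `2L` qudits is
`Op d (ZMod (2 * L))`. -/
abbrev Op (d : ℕ) (ι : Type) : Type := Matrix (ι → Fin d) (ι → Fin d) ℂ

/-- Matrices acting on two qudits. -/
abbrev Gate (d : ℕ) : Type := Matrix (Fin d × Fin d) (Fin d × Fin d) ℂ

/-- The dual gate: `⟨i| ⟨j| Ũ |k⟩ |l⟩ = ⟨l| ⟨j| U |k⟩ |i⟩`. -/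
def dualGate {d : ℕ} (U : Gate d) : Gate d :=
  Matrix.of fun p q => U (q.2, p.2) (q.1, p.1)

/-- A gate is dual-unitary if both the gate and its dual are unitary. -/
def IsDualUnitary {d : ℕ} (U : Gate d) : Prop :=
  U ∈ Matrix.unitaryGroup (Fin d × Fin d) ℂ ∧
    dualGate U ∈ Matrix.unitaryGroup (Fin d × Fin d) ℂ

/-- The partial trace over the site `i`, an operator on the remaining sites. -/
def partialTrace {d : ℕ} {ι : Type} [DecidableEq ι] (i : ι) (a : Op d ι) :
    Op d {j : ι // j ≠ i} :=
  Matrix.of fun σ τ => ∑ c : Fin d,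
    a ((Equiv.funSplitAt i (Fin d)).symm (c, σ)) ((Equiv.funSplitAt i (Fin d)).symm (c, τ))

/-- The operators of width `w` whose partial traces over the first site and over the last site
both vanish. -/
def boundaryTraceless (d w : ℕ) : Set (Op d (Fin w)) :=
  {a | ∀ i : Fin w, (i.val = 0 ∨ i.val + 1 = w) → partialTrace i a = 0}

/-- The operator `q_{x,…,x+w-1}` on the chain of `2L` sites: it acts as `q` on the sites
`x, x+1, …, x+w-1` (in this order, modulo `2L`) and as the identity on all other sites
(meant for `w ≤ 2L`). -/
def place {d L w : ℕ} [NeZero L] (x : ZMod (2 * L)) (q : Op d (Fin w)) : Op d (ZMod (2 * L)) :=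
  Matrix.of fun σ τ =>
    if ∀ y : ZMod (2 * L), (∀ i : Fin w, y ≠ x + (i.val : ZMod (2 * L))) → σ y = τ y then
      q (fun i => σ (x + (i.val : ZMod (2 * L)))) (fun i => τ (x + (i.val : ZMod (2 * L))))
    else 0

/-- The operator `U^{⊗ L}`: the gate `U` acts on each of the pairs of sites
`(0,1), (2,3), …, (2L-2,2L-1)`. -/
def gateLayer {d : ℕ} (L : ℕ) (U : Gate d) : Op d (ZMod (2 * L)) :=
  Matrix.of fun σ τ => ∏ k : Fin L,
    U (σ ((2 * k.val : ℕ) : ZMod (2 * L)), σ ((2 * k.val + 1 : ℕ) : ZMod (2 * L)))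
      (τ ((2 * k.val : ℕ) : ZMod (2 * L)), τ ((2 * k.val + 1 : ℕ) : ZMod (2 * L)))

/-- The periodic one-site translation `Π |i_0 i_1 … i_{2L-1}⟩ = |i_1 … i_{2L-1} i_0⟩`. -/
def translation (d L : ℕ) [NeZero L] : Op d (ZMod (2 * L)) :=
  Matrix.of fun σ τ => if σ = (fun y => τ (y + 1)) then 1 else 0

/-- The translation is an invertible matrix, so that its matrix inverse is the actual one. -/
theorem translation_mul_transpose (d L : ℕ) [NeZero L] :
    translation d L * (translation d L).transpose = 1 := by
  ext σ τ
  rw [Matrix.mul_apply, Finset.sum_eq_single (fun y => σ (y - 1))]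
  · simp only [translation, Matrix.transpose_apply, Matrix.of_apply, Matrix.one_apply,
      add_sub_cancel_right]
    by_cases h : τ = σ
    · subst h; simp
    · have h2 : ¬ σ = τ := fun e => h e.symm
      simp [h, h2]
  · intro ρ _ hρ
    have h : ¬ σ = (fun y => ρ (y + 1)) := by
      intro e
      apply hρ
      funext y
      simp [e]
    simp [translation, h]
  · simp

/-- The brickwork Floquet operator `𝕌 = Π V^{⊗ L} Π⁻¹ U^{⊗ L}` on `2L` qudits. -/
noncomputable def floquet {d : ℕ} (L : ℕ) [NeZero L] (U V : Gate d) : Op d (ZMod (2 * L)) :=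
  translation d L * gateLayer L V * (translation d L)⁻¹ * gateLayer L U

/-- `Q` is conserved under `𝕌`: `𝕌 Q 𝕌† = Q`. -/
def IsConserved {d : ℕ} {L : ℕ} [NeZero L] (U V : Gate d) (Q : Op d (ZMod (2 * L))) : Prop :=
  floquet L U V * Q * (floquet L U V).conjTranspose = Q

/-- The sum of the terms `q(x,w)_{x,…,x+w-1}` over all sites `x` and all widths
`1 ≤ w ≤ L - 4`. -/
def charge {d L : ℕ} [NeZero L] (q : ZMod (2 * L) → (w : ℕ) → Op d (Fin w)) :
    Op d (ZMod (2 * L)) :=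
  ∑ x : ZMod (2 * L), ∑ w ∈ Finset.Icc 1 (L - 4), place x (q x w)

/-- The even-even set: operators `a_{x,…,x+w-1}` with boundary-traceless `a`, even `x`
and even width `1 ≤ w ≤ L`. -/
def evenEven (d L : ℕ) [NeZero L] : Set (Op d (ZMod (2 * L))) :=
  {b | ∃ (x : ZMod (2 * L)) (w : ℕ) (a : Op d (Fin w)), Even x.val ∧ Even w ∧ 1 ≤ w ∧ w ≤ L ∧
    a ∈ boundaryTraceless d w ∧ b = place x a}

/-- The odd-even set: operators `a_{x,…,x+w-1}` with boundary-traceless `a`, odd `x`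
and even width `1 ≤ w ≤ L`. -/
def oddEven (d L : ℕ) [NeZero L] : Set (Op d (ZMod (2 * L))) :=
  {b | ∃ (x : ZMod (2 * L)) (w : ℕ) (a : Op d (Fin w)), Odd x.val ∧ Even w ∧ 1 ≤ w ∧ w ≤ L ∧
    a ∈ boundaryTraceless d w ∧ b = place x a}

/-- The terms contained in `Q`: all operators `a_{x,…,x+w-1}` with boundary-traceless `a`, any site
`x` and any width `1 ≤ w ≤ L - 4`, that have a nonzero overlap `tr (Q† a_{x,…,x+w-1})` with `Q`. -/
def termsOf {d L : ℕ} [NeZero L] (Q : Op d (ZMod (2 * L))) : Set (Op d (ZMod (2 * L))) :=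
  {b | ∃ (x : ZMod (2 * L)) (w : ℕ) (a : Op d (Fin w)), w ∈ Finset.Icc 1 (L - 4) ∧
    a ∈ boundaryTraceless d w ∧ b = place x a ∧ Matrix.trace (Q.conjTranspose * b) ≠ 0}

end DUC

namespace DUC

open Function Matrix
open scoped Kronecker

/-! All three claims follow from one fact: a conserved charge is orthogonal to every
boundary-traceless operator `a` of even width at most `L`, whatever the parity of its left end.

Even width puts both ends of `a` on inner legs of gates of the same layer, either the `U` layer (run
time forwards) or the `V` layer (run it backwards). Dual-unitarity then makes each end move
outwards: conjugating `1 ⊗ B` with `tr B = 0` gives an operator whose partial trace over the left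
leg vanishes, and symmetrically on the right (`IsDualUnitary.sum_conj_one_kronecker`,
`IsDualUnitary.sum_conj_kronecker_one`). The new ends are again inner legs for the next layer, so
one full period widens the operator by four sites (`IsStretched.conj_conj`).

Conservation preserves the overlap with the charge along this evolution. Increments of four cannot
jump over the widths in `(L - 4, L]`. There the operator is orthogonal to every term of the charge,
because stretched operators on different intervals are orthogonal (`IsStretched.trace_eq_zero`).
Hence the original overlap is zero (`trace_charge_mul_eq_zero_of_stretching`). The same
orthogonality isolates each term of the charge, so vanishing overlaps force even-width terms to
vanish. -/

theorem sum_sum_comm_sum_sum {α β γ δ M : Type*} [Fintype α] [Fintype β] [Fintype γ] [Fintype δ]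
    [AddCommMonoid M] (f : α → β → γ → δ → M) :
    ∑ a, ∑ b, ∑ c, ∑ e, f a b c e = ∑ c, ∑ e, ∑ a, ∑ b, f a b c e := by
  calc _ = ∑ q : α × β, ∑ q' : γ × δ, f q.1 q.2 q'.1 q'.2 := by
        simp only [Fintype.sum_prod_type]
    _ = _ := by rw [Finset.sum_comm]; simp only [Fintype.sum_prod_type]

/-! ### Triviality and tracelessness at a site, and two-site blocks. -/

section Sites

variable {d : ℕ} {ι : Type} [DecidableEq ι]

/-- The operator `a` acts as the identity on the site `i`. -/
def TrivialAt (i : ι) (a : Op d ι) : Prop :=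
  ∀ σ τ, (σ i ≠ τ i → a σ τ = 0) ∧
    (σ i = τ i → ∀ c, a (update σ i c) (update τ i c) = a σ τ)

/-- The partial trace of `a` over the site `i` vanishes. -/
def TracelessAt (i : ι) (a : Op d ι) : Prop :=
  ∀ σ τ, ∑ c, a (update σ i c) (update τ i c) = 0

/-- Operators acting trivially on a site are orthogonal to those traceless there. -/
theorem trace_conjTranspose_mul_eq_zero [Fintype ι] {i : ι} {a b : Op d ι}
    (ha : TrivialAt i a) (hb : TracelessAt i b) : trace (aᴴ * b) = 0 := by
  let e := (Equiv.funSplitAt i (Fin d)).symm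
  have he : ∀ c c' s, update (e (c, s)) i c' = e (c', s) := by
    intro c c' s
    funext j
    by_cases h : j = i
    · subst h; simp [e, Equiv.funSplitAt, Equiv.piSplitAt]
    · simp [e, Equiv.funSplitAt, Equiv.piSplitAt, h]
  have hei : ∀ c s, e (c, s) i = c := by
    intro c s; simp [e, Equiv.funSplitAt, Equiv.piSplitAt]
  have key : trace (aᴴ * b) = ∑ τ, ∑ σ, star (a σ τ) * b σ τ := by
    simp [trace, mul_apply]
  rw [key, ← e.sum_comp]
  simp_rw [← e.sum_comp (fun σ => star (a σ _) * b σ _), Fintype.sum_prod_type]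
  -- Triviality of `a` leaves only equal values at `i`. The surviving entry of `a` does not depend
  -- on that value, so it factors out of the partial trace of `b`.
  have h1 : ∀ c c' s t, star (a (e (c', t)) (e (c, s))) * b (e (c', t)) (e (c, s)) =
      if c' = c then star (a (e (c', t)) (e (c, s))) * b (e (c', t)) (e (c, s)) else 0 := by
    intro c c' s t
    split_ifs with h
    · rfl
    · rw [(ha _ _).1 (by simpa [hei] using h)]; simp
  rw [Finset.sum_comm]
  refine Finset.sum_eq_zero fun s _ => ?_
  calc _ = ∑ c, ∑ t, star (a (e (c, t)) (e (c, s))) * b (e (c, t)) (e (c, s)) := by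
        refine Finset.sum_congr rfl fun c _ => ?_
        rw [Finset.sum_comm]
        refine Finset.sum_congr rfl fun t _ => ?_
        rw [Finset.sum_congr rfl fun c' _ => h1 c c' s t]
        simp
    _ = 0 := by
        rw [Finset.sum_comm]
        refine Finset.sum_eq_zero fun t _ => ?_
        rcases isEmpty_or_nonempty (Fin d) with _ | ⟨⟨c₀⟩⟩
        · simp
        · have h2 : ∀ c, a (e (c, t)) (e (c, s)) = a (e (c₀, t)) (e (c₀, s)) := by
            intro c
            have := (ha (e (c₀, t)) (e (c₀, s))).2 (by simp [hei]) c
            rwa [he, he] at this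
          simp_rw [h2, ← Finset.mul_sum]
          have := hb (e (c₀, t)) (e (c₀, s))
          simp_rw [he] at this
          rw [this, mul_zero]

/-- Configurations, split into the values at the two sites `l` and `r` and the remaining ones. -/
def splitPair (d : ℕ) {l r : ι} (h : l ≠ r) :
    (Fin d × Fin d) × ({j : ι // j ≠ l ∧ j ≠ r} → Fin d) ≃ (ι → Fin d) where
  toFun q j := if hl : j = l then q.1.1 else if hr : j = r then q.1.2 else q.2 ⟨j, hl, hr⟩
  invFun σ := ((σ l, σ r), fun j => σ j)
  left_inv q := by
    ext j
    · simp
    · simp [h.symm]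
    · simp [j.2.1, j.2.2]
  right_inv σ := by
    funext j
    by_cases hl : j = l
    · simp [hl]
    · by_cases hr : j = r
      · subst hr; simp [hl]
      · simp [hl, hr]

theorem splitPair_left {l r : ι} (h : l ≠ r) (q) : splitPair d h q l = q.1.1 := by
  simp [splitPair]

theorem splitPair_right {l r : ι} (h : l ≠ r) (q) : splitPair d h q r = q.1.2 := by
  simp [splitPair, h.symm]

theorem splitPair_of_ne {l r : ι} (h : l ≠ r) (q) {j : ι} (hl : j ≠ l) (hr : j ≠ r) :
    splitPair d h q j = q.2 ⟨j, hl, hr⟩ := by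
  simp [splitPair, hl, hr]

theorem update_splitPair_left {l r : ι} (h : l ≠ r) (c c₁ c₂ : Fin d) (s) :
    update (splitPair d h ((c₁, c₂), s)) l c = splitPair d h ((c, c₂), s) := by
  funext j
  by_cases hl : j = l
  · subst hl; simp [splitPair]
  · simp [splitPair, hl]

theorem update_splitPair_right {l r : ι} (h : l ≠ r) (c c₁ c₂ : Fin d) (s) :
    update (splitPair d h ((c₁, c₂), s)) r c = splitPair d h ((c₁, c), s) := by
  funext j
  by_cases hr : j = r
  · subst hr; simp [splitPair, h.symm]
  · simp [splitPair, hr]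

/-- The two-site blocks of an operator, indexed by the configurations of the other sites. -/
def block {l r : ι} (h : l ≠ r) (a : Op d ι) (s t : {j : ι // j ≠ l ∧ j ≠ r} → Fin d) : Gate d :=
  of fun p p' => a (splitPair d h (p, s)) (splitPair d h (p', t))

/-- The block does not depend on the common value at `l`, so `B` can be read off at one fixed value
`c₀`. -/
theorem TrivialAt.exists_block_left {l r : ι} (h : l ≠ r) {a : Op d ι} (ha : TrivialAt l a) (s t) :
    ∃ B : Matrix (Fin d) (Fin d) ℂ, block h a s t = (1 : Matrix (Fin d) (Fin d) ℂ) ⊗ₖ B := by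
  rcases isEmpty_or_nonempty (Fin d) with _ | ⟨⟨c₀⟩⟩
  · exact ⟨0, Subsingleton.elim _ _⟩
  refine ⟨of fun c c' => block h a s t (c₀, c) (c₀, c'), ?_⟩
  ext ⟨c₁, c₂⟩ ⟨c₁', c₂'⟩
  have key := ha (splitPair d h ((c₁, c₂), s)) (splitPair d h ((c₁', c₂'), t))
  rw [splitPair_left, splitPair_left] at key
  by_cases hc : c₁ = c₁'
  · have := key.2 hc c₀
    rw [update_splitPair_left, update_splitPair_left] at this
    simp [block, this, hc]
  · simp [block, key.1 hc, hc]

theorem TrivialAt.exists_block_right {l r : ι} (h : l ≠ r) {a : Op d ι} (ha : TrivialAt r a)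
    (s t) :
    ∃ B : Matrix (Fin d) (Fin d) ℂ, block h a s t = B ⊗ₖ (1 : Matrix (Fin d) (Fin d) ℂ) := by
  rcases isEmpty_or_nonempty (Fin d) with _ | ⟨⟨c₀⟩⟩
  · exact ⟨0, Subsingleton.elim _ _⟩
  refine ⟨of fun c c' => block h a s t (c, c₀) (c', c₀), ?_⟩
  ext ⟨c₁, c₂⟩ ⟨c₁', c₂'⟩
  have key := ha (splitPair d h ((c₁, c₂), s)) (splitPair d h ((c₁', c₂'), t))
  rw [splitPair_right, splitPair_right] at key
  by_cases hc : c₂ = c₂'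
  · have := key.2 hc c₀
    rw [update_splitPair_right, update_splitPair_right] at this
    simp [block, this, hc]
  · simp [block, key.1 hc, hc]

/-- A matrix that is both `1 ⊗ B` and `C ⊗ 1` is scalar. -/
theorem TrivialAt.exists_block_eq_smul {l r : ι} (h : l ≠ r) {a : Op d ι} (hl : TrivialAt l a)
    (hr : TrivialAt r a) (s t) : ∃ β : ℂ, block h a s t = β • 1 := by
  rcases isEmpty_or_nonempty (Fin d) with _ | ⟨⟨c₀⟩⟩
  · exact ⟨0, Subsingleton.elim _ _⟩
  obtain ⟨B, hB⟩ := hl.exists_block_left h s t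
  obtain ⟨C, hC⟩ := hr.exists_block_right h s t
  refine ⟨B c₀ c₀, ?_⟩
  ext ⟨c₁, c₂⟩ ⟨c₁', c₂'⟩
  have h1 := congrFun (congrFun hC (c₁, c₂)) (c₁', c₂')
  have h2 := congrFun (congrFun hC (c₁, c₀)) (c₁', c₀)
  rw [hB] at h1 h2
  rw [hB]
  clear hB hC
  simp only [kroneckerMap_apply, one_apply, Matrix.smul_apply, Prod.mk.injEq, smul_eq_mul] at h1 h2 ⊢
  by_cases e1 : c₁ = c₁' <;> by_cases e2 : c₂ = c₂' <;> grind

theorem trivialAt_left_of_block {l r : ι} (h : l ≠ r) {a : Op d ι}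
    (H : ∀ s t, ∃ β : ℂ, block h a s t = β • 1) : TrivialAt l a := by
  intro σ τ
  obtain ⟨⟨⟨c₁, c₂⟩, s⟩, rfl⟩ := (splitPair d h).surjective σ
  obtain ⟨⟨⟨c₁', c₂'⟩, t⟩, rfl⟩ := (splitPair d h).surjective τ
  obtain ⟨β, hβ⟩ := H s t
  have key : ∀ p p', a (splitPair d h (p, s)) (splitPair d h (p', t)) = if p = p' then β else 0 := by
    intro p p'
    have := congrFun (congrFun hβ p) p'
    simpa [block, one_apply] using this
  simp only [splitPair_left, update_splitPair_left, key, Prod.mk.injEq]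
  grind

theorem trivialAt_right_of_block {l r : ι} (h : l ≠ r) {a : Op d ι}
    (H : ∀ s t, ∃ β : ℂ, block h a s t = β • 1) : TrivialAt r a := by
  intro σ τ
  obtain ⟨⟨⟨c₁, c₂⟩, s⟩, rfl⟩ := (splitPair d h).surjective σ
  obtain ⟨⟨⟨c₁', c₂'⟩, t⟩, rfl⟩ := (splitPair d h).surjective τ
  obtain ⟨β, hβ⟩ := H s t
  have key : ∀ p p', a (splitPair d h (p, s)) (splitPair d h (p', t)) = if p = p' then β else 0 := by
    intro p p'
    have := congrFun (congrFun hβ p) p'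
    simpa [block, one_apply] using this
  simp only [splitPair_right, update_splitPair_right, key, Prod.mk.injEq]
  grind

theorem tracelessAt_left_iff {l r : ι} (h : l ≠ r) {a : Op d ι} :
    TracelessAt l a ↔ ∀ s t b b', ∑ c, block h a s t (c, b) (c, b') = 0 := by
  constructor
  · intro ha s t b b'
    rcases isEmpty_or_nonempty (Fin d) with _ | ⟨⟨c₀⟩⟩
    · simp
    have := ha (splitPair d h ((c₀, b), s)) (splitPair d h ((c₀, b'), t))
    simpa only [update_splitPair_left, block, of_apply] using this
  · intro H σ τ
    obtain ⟨⟨⟨c₁, c₂⟩, s⟩, rfl⟩ := (splitPair d h).surjective σ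
    obtain ⟨⟨⟨c₁', c₂'⟩, t⟩, rfl⟩ := (splitPair d h).surjective τ
    simpa only [update_splitPair_left, block, of_apply] using H s t c₂ c₂'

theorem tracelessAt_right_iff {l r : ι} (h : l ≠ r) {a : Op d ι} :
    TracelessAt r a ↔ ∀ s t b b', ∑ c, block h a s t (b, c) (b', c) = 0 := by
  constructor
  · intro ha s t b b'
    rcases isEmpty_or_nonempty (Fin d) with _ | ⟨⟨c₀⟩⟩
    · simp
    have := ha (splitPair d h ((b, c₀), s)) (splitPair d h ((b', c₀), t))
    simpa only [update_splitPair_right, block, of_apply] using this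
  · intro H σ τ
    obtain ⟨⟨⟨c₁, c₂⟩, s⟩, rfl⟩ := (splitPair d h).surjective σ
    obtain ⟨⟨⟨c₁', c₂'⟩, t⟩, rfl⟩ := (splitPair d h).surjective τ
    simpa only [update_splitPair_right, block, of_apply] using H s t c₁ c₁'

/-- The operator `G` is a product of the gate `U` on the sites `l`, `r` and an operator on the
other sites. -/
def FactorsAt {l r : ι} (h : l ≠ r) (U : Gate d) (G : Op d ι) : Prop :=
  ∃ R : Op d {j : ι // j ≠ l ∧ j ≠ r}, ∀ p s p' s',
    G (splitPair d h (p, s)) (splitPair d h (p', s')) = U p p' * R s s'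

/-- Since `R` ignores `l` and `r`, freezing both at `c₀` turns it into an operator on the other
sites. -/
theorem factorsAt_of_eq_mul {l r : ι} (h : l ≠ r) {U : Gate d} {G R : Op d ι}
    (hG : ∀ σ τ, G σ τ = U (σ l, σ r) (τ l, τ r) * R σ τ)
    (hR : ∀ σ σ' τ τ', (∀ j, j ≠ l → j ≠ r → σ j = σ' j) → (∀ j, j ≠ l → j ≠ r → τ j = τ' j) →
      R σ τ = R σ' τ') : FactorsAt h U G := by
  rcases isEmpty_or_nonempty (Fin d) with _ | ⟨⟨c₀⟩⟩
  · exact ⟨0, fun p => isEmptyElim p.1⟩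
  refine ⟨of fun s s' => R (splitPair d h ((c₀, c₀), s)) (splitPair d h ((c₀, c₀), s')),
    fun p s p' s' => ?_⟩
  rw [hG, of_apply]
  simp only [splitPair_left, splitPair_right]
  congr 1
  refine hR _ _ _ _ ?_ ?_ <;>
  · intro j hl hr
    rw [splitPair_of_ne h _ hl hr, splitPair_of_ne h _ hl hr]

theorem FactorsAt.conjTranspose {l r : ι} {h : l ≠ r} {U : Gate d} {G : Op d ι}
    (hG : FactorsAt h U G) : FactorsAt h Uᴴ Gᴴ := by
  obtain ⟨R, hR⟩ := hG
  exact ⟨Rᴴ, fun p s p' s' => by simp [hR]⟩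

/-- Conjugation by `G` acts on the blocks by conjugation with the gate, up to recombination. -/
theorem FactorsAt.exists_block_conj [Fintype ι] {l r : ι} {h : l ≠ r} {U : Gate d} {G : Op d ι}
    (hG : FactorsAt h U G) (a : Op d ι) :
    ∃ R : Op d {j : ι // j ≠ l ∧ j ≠ r}, ∀ s s', block h (G * a * Gᴴ) s s' =
      ∑ t, ∑ t', (R s t * star (R s' t')) • (U * block h a t t' * Uᴴ) := by
  -- The rest `R` of the layer only supplies coefficients of a linear combination of blocks, so no
  -- unitarity is required of it.
  obtain ⟨R, hR⟩ := hG
  refine ⟨R, fun s s' => ?_⟩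
  ext p p'
  have hl : block h (G * a * Gᴴ) s s' p p' = ∑ τ, ∑ σ,
      G (splitPair d h (p, s)) σ * a σ τ * star (G (splitPair d h (p', s')) τ) := by
    simp [block, mul_apply, Finset.sum_mul]
  have hr : ∀ t t', (U * block h a t t' * Uᴴ) p p' = ∑ q', ∑ q, U p q *
      a (splitPair d h (q, t)) (splitPair d h (q', t')) * star (U p' q') := by
    simp [block, mul_apply, Finset.sum_mul]
  rw [hl, ← (splitPair d h).sum_comp]
  simp_rw [← (splitPair d h).sum_comp (fun σ => G _ σ * a σ _ * _)]
  simp only [Fintype.sum_prod_type_right (α₁ := Fin d × Fin d), hR, Matrix.sum_apply,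
    Matrix.smul_apply, hr, smul_eq_mul, Finset.mul_sum]
  conv_rhs => rw [Finset.sum_comm]
  refine Finset.sum_congr rfl fun t _ => ?_
  rw [Finset.sum_comm]
  refine Finset.sum_congr rfl fun t' _ => Finset.sum_congr rfl fun q' _ =>
    Finset.sum_congr rfl fun q _ => ?_
  simp only [star_mul']
  ring

end Sites

/-! ### Dual-unitary gates. -/

/-- Conjugating `1 ⊗ B` by a dual-unitary gate gives `tr B` after tracing out the left site. -/
theorem IsDualUnitary.sum_conj_one_kronecker {d : ℕ} {U : Gate d} (hU : IsDualUnitary U)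
    (B : Matrix (Fin d) (Fin d) ℂ) (hB : trace B = 0) (b b' : Fin d) :
    ∑ c, (U * ((1 : Matrix (Fin d) (Fin d) ℂ) ⊗ₖ B) * Uᴴ) (c, b) (c, b') = 0 := by
  -- Unitarity of the dual gate, in the form `Ũ Ũ† = 1`, says exactly that contracting both left
  -- legs of `U` with those of its conjugate gives the identity.
  have key : ∀ j j', ∑ c, ∑ k, U (c, b) (k, j) * star (U (c, b') (k, j')) =
      if j = j' ∧ b = b' then 1 else 0 := by
    intro j j'
    have := congrFun (congrFun (mem_unitaryGroup_iff.1 hU.2) (j, b)) (j', b')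
    simp only [mul_apply, star_apply, dualGate, of_apply, Fintype.sum_prod_type, one_apply,
      Prod.mk.injEq] at this
    rw [Finset.sum_comm, this]
  calc _ = ∑ c, ∑ k, ∑ j', ∑ j, B j j' * (U (c, b) (k, j) * star (U (c, b') (k, j'))) := by
        simp only [mul_apply, Fintype.sum_prod_type, kroneckerMap_apply, one_apply,
          conjTranspose_apply, Finset.sum_mul, ite_mul, mul_ite, one_mul, zero_mul, mul_zero]
        refine Finset.sum_congr rfl fun c _ => Finset.sum_congr rfl fun k _ =>
          Finset.sum_congr rfl fun j' _ => ?_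
        rw [Finset.sum_comm]
        refine Finset.sum_congr rfl fun j _ => ?_
        simp
        ring
    _ = ∑ j', ∑ j, B j j' * ∑ c, ∑ k, U (c, b) (k, j) * star (U (c, b') (k, j')) := by
        simp only [Finset.mul_sum]
        exact sum_sum_comm_sum_sum _
    _ = 0 := by
        simp only [key]
        by_cases hb : b = b'
        · simpa [hb, trace] using hB
        · simp [hb]

/-- Conjugating `B ⊗ 1` by a dual-unitary gate gives `tr B` after tracing out the right site. -/
theorem IsDualUnitary.sum_conj_kronecker_one {d : ℕ} {U : Gate d} (hU : IsDualUnitary U)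
    (B : Matrix (Fin d) (Fin d) ℂ) (hB : trace B = 0) (b b' : Fin d) :
    ∑ c, (U * (B ⊗ₖ (1 : Matrix (Fin d) (Fin d) ℂ)) * Uᴴ) (b, c) (b', c) = 0 := by
  -- The right legs are contracted by the other relation, `Ũ† Ũ = 1`.
  have key : ∀ j j', ∑ c, ∑ k, U (b, c) (j, k) * star (U (b', c) (j', k)) =
      if j = j' ∧ b = b' then 1 else 0 := by
    intro j j'
    have := congrFun (congrFun (mem_unitaryGroup_iff'.1 hU.2) (j', b')) (j, b)
    simp only [mul_apply, star_apply, dualGate, of_apply, Fintype.sum_prod_type, one_apply,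
      Prod.mk.injEq] at this
    rw [Finset.sum_comm]
    simp only [mul_comm (U _ _), this, eq_comm]
  calc _ = ∑ c, ∑ k, ∑ j', ∑ j, B j j' * (U (b, c) (j, k) * star (U (b', c) (j', k))) := by
        simp only [mul_apply, Fintype.sum_prod_type_right, kroneckerMap_apply, one_apply,
          conjTranspose_apply, Finset.sum_mul, ite_mul, mul_ite, zero_mul, mul_zero, mul_one]
        refine Finset.sum_congr rfl fun c _ => Finset.sum_congr rfl fun k _ =>
          Finset.sum_congr rfl fun j' _ => ?_
        rw [Finset.sum_comm]
        refine Finset.sum_congr rfl fun j _ => ?_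
        simp
        ring
    _ = ∑ j', ∑ j, B j j' * ∑ c, ∑ k, U (b, c) (j, k) * star (U (b', c) (j', k)) := by
        simp only [Finset.mul_sum]
        exact sum_sum_comm_sum_sum _
    _ = 0 := by
        simp only [key]
        by_cases hb : b = b'
        · simpa [hb, trace] using hB
        · simp [hb]

/-- The adjoint of a dual-unitary gate is dual-unitary. -/
theorem IsDualUnitary.conjTranspose {d : ℕ} {U : Gate d} (hU : IsDualUnitary U) :
    IsDualUnitary Uᴴ := by
  refine ⟨Unitary.star_mem hU.1, ?_⟩
  -- The dual of `Uᴴ` is the entrywise conjugate of the dual of `U` with its two sites swapped. Both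
  -- operations preserve unitarity.
  have h : dualGate Uᴴ = (star (dualGate U)).transpose.submatrix Prod.swap Prod.swap := by
    ext p q
    simp [dualGate, star_apply]
  rw [mem_unitaryGroup_iff]
  ext p q
  have := congrFun (congrFun (mem_unitaryGroup_iff.1 hU.2) q.swap) p.swap
  simp only [h, mul_apply, star_apply, submatrix_apply, transpose_apply, star_star, one_apply]
    at this ⊢
  rw [← (Equiv.prodComm (Fin d) (Fin d)).sum_comp]
  simp only [Equiv.prodComm_apply, Prod.swap_swap, mul_comm (star _), this, Prod.swap_inj, eq_comm]

/-! ### How a gate layer acts at the two legs of one gate. -/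

section Layers

variable {d : ℕ} {ι : Type} [DecidableEq ι] [Fintype ι] {l r : ι} {h : l ≠ r} {U : Gate d}
  {G a : Op d ι}

/-- Scalar blocks commute past `U`, and `U * Uᴴ = 1`, so the new blocks are combinations of scalars.
-/
theorem FactorsAt.exists_block_eq_smul (hG : FactorsAt h U G) (hU : IsDualUnitary U)
    (hl : TrivialAt l a) (hr : TrivialAt r a) (s t) :
    ∃ β : ℂ, block h (G * a * Gᴴ) s t = β • 1 := by
  obtain ⟨R, hR⟩ := hG.exists_block_conj a
  choose β hβ using hl.exists_block_eq_smul h hr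
  refine ⟨∑ u, ∑ u', R s u * star (R t u') * β u u', ?_⟩
  have hUU : U * Uᴴ = 1 := mem_unitaryGroup_iff.1 hU.1
  simp only [hR, hβ, Matrix.mul_smul, Matrix.smul_mul, mul_one, hUU, smul_smul, Finset.sum_smul]

/-- A gate layer keeps an operator trivial on the pairs on which it is trivial. -/
theorem FactorsAt.trivialAt_left (hG : FactorsAt h U G) (hU : IsDualUnitary U)
    (hl : TrivialAt l a) (hr : TrivialAt r a) : TrivialAt l (G * a * Gᴴ) :=
  trivialAt_left_of_block h (hG.exists_block_eq_smul hU hl hr)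

theorem FactorsAt.trivialAt_right (hG : FactorsAt h U G) (hU : IsDualUnitary U)
    (hl : TrivialAt l a) (hr : TrivialAt r a) : TrivialAt r (G * a * Gᴴ) :=
  trivialAt_right_of_block h (hG.exists_block_eq_smul hU hl hr)

/-- An operator whose left edge is the right leg of a gate has its edge moved to the left leg. -/
theorem FactorsAt.tracelessAt_left (hG : FactorsAt h U G) (hU : IsDualUnitary U)
    (hl : TrivialAt l a) (hr : TracelessAt r a) : TracelessAt l (G * a * Gᴴ) := by
  obtain ⟨R, hR⟩ := hG.exists_block_conj a
  rw [tracelessAt_left_iff h]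
  rw [tracelessAt_right_iff h] at hr
  rcases isEmpty_or_nonempty (Fin d) with _ | ⟨⟨c₀⟩⟩
  · simp
  intro s t b b'
  simp only [hR, Matrix.sum_apply, Matrix.smul_apply]
  rw [Finset.sum_comm]
  refine Finset.sum_eq_zero fun u _ => ?_
  rw [Finset.sum_comm]
  refine Finset.sum_eq_zero fun u' _ => ?_
  obtain ⟨B, hB⟩ := hl.exists_block_left h u u'
  have htr : trace B = 0 := by
    have := hr u u' c₀ c₀
    simpa [hB, trace] using this
  rw [← Finset.smul_sum, hB, hU.sum_conj_one_kronecker B htr, smul_zero]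

/-- An operator whose right edge is the left leg of a gate has its edge moved to the right leg. -/
theorem FactorsAt.tracelessAt_right (hG : FactorsAt h U G) (hU : IsDualUnitary U)
    (hr : TrivialAt r a) (hl : TracelessAt l a) : TracelessAt r (G * a * Gᴴ) := by
  obtain ⟨R, hR⟩ := hG.exists_block_conj a
  rw [tracelessAt_right_iff h]
  rw [tracelessAt_left_iff h] at hl
  rcases isEmpty_or_nonempty (Fin d) with _ | ⟨⟨c₀⟩⟩
  · simp
  intro s t b b'
  simp only [hR, Matrix.sum_apply, Matrix.smul_apply]
  rw [Finset.sum_comm]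
  refine Finset.sum_eq_zero fun u _ => ?_
  rw [Finset.sum_comm]
  refine Finset.sum_eq_zero fun u' _ => ?_
  obtain ⟨B, hB⟩ := hr.exists_block_right h u u'
  have htr : trace B = 0 := by
    have := hl u u' c₀ c₀
    simpa [hB, trace] using this
  rw [← Finset.smul_sum, hB, hU.sum_conj_kronecker_one B htr, smul_zero]

end Layers

/-! ### The periodic chain and its gate layers. -/

section Ring

variable {d L : ℕ} [NeZero L]

theorem site_eq_iff {L : ℕ} {i j : ℕ} (hi : i < 2 * L) (hj : j < 2 * L) :
    (i : ZMod (2 * L)) = j ↔ i = j := by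
  rw [ZMod.natCast_eq_natCast_iff', Nat.mod_eq_of_lt hi, Nat.mod_eq_of_lt hj]

/-- The modulus is even, so parity survives reduction: `2r` depends only on `r` modulo `L`. -/
theorem exists_fin_eq_of_even {l : ZMod (2 * L)} (hl : Even l) :
    ∃ k : Fin L, l = ((2 * k.val : ℕ) : ZMod (2 * L)) := by
  have hL : 0 < L := NeZero.pos L
  obtain ⟨r, rfl⟩ := hl
  refine ⟨⟨r.val % L, Nat.mod_lt _ hL⟩, ?_⟩
  conv_lhs => rw [← ZMod.natCast_zmod_val r, ← Nat.cast_add, ← two_mul]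
  rw [ZMod.natCast_eq_natCast_iff', ← Nat.mul_mod_mul_left, Nat.mod_mod]

theorem even_of_even_val {x : ZMod (2 * L)} (h : Even x.val) : Even x := by
  rw [← ZMod.natCast_zmod_val x]
  exact h.natCast

theorem even_sub_one_of_odd_val {x : ZMod (2 * L)} (h : Odd x.val) : Even (x - 1) := by
  obtain ⟨k, hk⟩ := h
  rw [← ZMod.natCast_zmod_val x, hk]
  push_cast
  exact ⟨k, by ring⟩

theorem even_or_even_sub_one (x : ZMod (2 * L)) : Even x ∨ Even (x - 1) :=
  (Nat.even_or_odd x.val).imp even_of_even_val even_sub_one_of_odd_val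

theorem ne_add_one (l : ZMod (2 * L)) : l ≠ l + 1 := by
  have hL : 0 < L := NeZero.pos L
  intro h
  have h0 : ((0 : ℕ) : ZMod (2 * L)) = (1 : ℕ) := by
    push_cast
    exact add_left_cancel (a := l) (by simpa using h)
  rw [site_eq_iff (by omega) (by omega)] at h0
  omega

/-- Configurations of the chain as configurations of its `L` pairs of sites. -/
def pairConfig (d L : ℕ) [NeZero L] : (ZMod (2 * L) → Fin d) ≃ (Fin L → Fin d × Fin d) where
  toFun σ k := (σ ((2 * k.val : ℕ) : ZMod (2 * L)), σ ((2 * k.val + 1 : ℕ) : ZMod (2 * L)))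
  invFun f y :=
    have hy : y.val / 2 < L := by have := ZMod.val_lt y; omega
    if y.val % 2 = 0 then (f ⟨y.val / 2, hy⟩).1 else (f ⟨y.val / 2, hy⟩).2
  left_inv σ := by
    funext y
    have hy := ZMod.natCast_zmod_val y
    by_cases h : y.val % 2 = 0
    · have h2 : 2 * (y.val / 2) = y.val := by omega
      simp only [h, if_true, h2, hy]
    · have h2 : 2 * (y.val / 2) + 1 = y.val := by omega
      simp only [h, if_false, h2, hy]
  right_inv f := by
    funext k
    have hk := k.2
    have h1 : ((2 * k.val : ℕ) : ZMod (2 * L)).val = 2 * k.val :=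
      ZMod.val_natCast_of_lt (by omega)
    have h2 : ((2 * k.val + 1 : ℕ) : ZMod (2 * L)).val = 2 * k.val + 1 :=
      ZMod.val_natCast_of_lt (by omega)
    have h3 : (2 * k.val + 1) / 2 = k.val := by omega
    have h4 : (2 * k.val + 1) % 2 = 1 := by omega
    simp only [h1, h2, h3, h4]
    simp

/-- In pair coordinates the sum over intermediate configurations factors into one sum per gate. -/
theorem gateLayer_mul_conjTranspose {U : Gate d} (hU : U * Uᴴ = 1) :
    gateLayer L U * (gateLayer L U)ᴴ = 1 := by
  ext σ τ
  have h1 : (gateLayer L U * (gateLayer L U)ᴴ) σ τ = ∑ f : Fin L → Fin d × Fin d, ∏ k,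
      U (pairConfig d L σ k) (f k) * star (U (pairConfig d L τ k) (f k)) := by
    rw [← (pairConfig d L).sum_comp]
    simp only [mul_apply, conjTranspose_apply, Finset.prod_mul_distrib]
    refine Finset.sum_congr rfl fun ρ _ => ?_
    simp [gateLayer, pairConfig]
  have h2 : ∀ p p', ∑ x, U p x * star (U p' x) = if p = p' then 1 else 0 := by
    intro p p'
    have := congrFun (congrFun hU p) p'
    simpa [mul_apply, one_apply] using this
  rw [h1, ← Fintype.piFinset_univ, ← Finset.prod_univ_sum (fun _ => Finset.univ)
    (fun k x => U (pairConfig d L σ k) x * star (U (pairConfig d L τ k) x))]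
  simp only [h2, Finset.prod_ite_zero, one_apply, Finset.mem_univ, true_implies,
    ← funext_iff (f := pairConfig d L σ), (pairConfig d L).injective.eq_iff, Finset.prod_const_one]

theorem gateLayer_eq_mul (U : Gate d) {l : ZMod (2 * L)} (hl : Even l) :
    ∃ R : Op d (ZMod (2 * L)),
      (∀ σ τ, gateLayer L U σ τ = U (σ l, σ (l + 1)) (τ l, τ (l + 1)) * R σ τ) ∧
      ∀ σ σ' τ τ', (∀ j, j ≠ l → j ≠ l + 1 → σ j = σ' j) →
        (∀ j, j ≠ l → j ≠ l + 1 → τ j = τ' j) → R σ τ = R σ' τ' := by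
  obtain ⟨k, rfl⟩ := exists_fin_eq_of_even hl
  refine ⟨of fun σ τ => ∏ k' ∈ Finset.univ.erase k,
    U (σ ((2 * k'.val : ℕ) : ZMod (2 * L)), σ ((2 * k'.val + 1 : ℕ) : ZMod (2 * L)))
      (τ ((2 * k'.val : ℕ) : ZMod (2 * L)), τ ((2 * k'.val + 1 : ℕ) : ZMod (2 * L))), ?_, ?_⟩
  · intro σ τ
    simp only [gateLayer, of_apply, ← Nat.cast_succ]
    rw [← Finset.mul_prod_erase Finset.univ _ (Finset.mem_univ k)]
  · intro σ σ' τ τ' hσ hτ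
    simp only [of_apply]
    refine Finset.prod_congr rfl fun k' hk' => ?_
    have hne : k'.val ≠ k.val := fun e => (Finset.mem_erase.1 hk').1 (Fin.ext e)
    have hk := k.2
    have hk'2 := k'.2
    have n1 : ((2 * k'.val : ℕ) : ZMod (2 * L)) ≠ (2 * k.val : ℕ) := by
      rw [Ne, site_eq_iff] <;> omega
    have n2 : ((2 * k'.val : ℕ) : ZMod (2 * L)) ≠ (2 * k.val : ℕ) + 1 := by
      rw [← Nat.cast_succ, Ne, site_eq_iff] <;> omega
    have n3 : ((2 * k'.val + 1 : ℕ) : ZMod (2 * L)) ≠ (2 * k.val : ℕ) := by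
      rw [Ne, site_eq_iff] <;> omega
    have n4 : ((2 * k'.val + 1 : ℕ) : ZMod (2 * L)) ≠ (2 * k.val : ℕ) + 1 := by
      rw [← Nat.cast_succ, Ne, site_eq_iff] <;> omega
    rw [hσ _ n1 n2, hσ _ n3 n4, hτ _ n1 n2, hτ _ n3 n4]

/-- The operator `G` factors into gates `U` on the pairs of sites `(l, l + 1)` with `l + c` even. -/
def IsLayer (c : ZMod (2 * L)) (U : Gate d) (G : Op d (ZMod (2 * L))) : Prop :=
  ∀ l, Even (l + c) → FactorsAt (ne_add_one l) U G

theorem IsLayer.conjTranspose {c : ZMod (2 * L)} {U : Gate d} {G : Op d (ZMod (2 * L))}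
    (hG : IsLayer c U G) : IsLayer c Uᴴ Gᴴ := fun l hl => (hG l hl).conjTranspose

theorem isLayer_gateLayer (U : Gate d) : IsLayer 0 U (gateLayer L U) := by
  intro l hl
  obtain ⟨R, h1, h2⟩ := gateLayer_eq_mul U (by simpa using hl)
  exact factorsAt_of_eq_mul _ h1 h2

theorem translation_inv : (translation d L)⁻¹ = (translation d L)ᵀ :=
  inv_eq_right_inv (translation_mul_transpose d L)

theorem translation_conj_apply (G : Op d (ZMod (2 * L))) (σ τ) :
    (translation d L * G * (translation d L)⁻¹) σ τ =
      G (fun y => σ (y - 1)) (fun y => τ (y - 1)) := by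
  have key : ∀ σ ρ, translation d L σ ρ = if ρ = (fun y => σ (y - 1)) then 1 else 0 := by
    intro σ ρ
    simp only [translation, of_apply]
    congr 1
    refine propext ⟨?_, ?_⟩ <;> rintro rfl <;> simp
  simp [translation_inv, mul_apply, key]

theorem isLayer_translation_conj (U : Gate d) :
    IsLayer 1 U (translation d L * gateLayer L U * (translation d L)⁻¹) := by
  intro l hl
  obtain ⟨R, h1, h2⟩ := gateLayer_eq_mul U hl
  refine factorsAt_of_eq_mul (R := of fun σ τ => R (fun y => σ (y - 1)) (fun y => τ (y - 1))) _
    ?_ ?_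
  · intro σ τ
    simp [translation_conj_apply, h1]
  · intro σ σ' τ τ' hσ hτ
    refine h2 _ _ _ _ ?_ ?_
    · intro j h3 h4
      exact hσ _ (fun e => h3 (by rw [← e]; ring)) (fun e => h4 (by rw [← e]; ring))
    · intro j h3 h4
      exact hτ _ (fun e => h3 (by rw [← e]; ring)) (fun e => h4 (by rw [← e]; ring))

theorem floquet_mul_conjTranspose {U V : Gate d} (hU : U * Uᴴ = 1) (hV : V * Vᴴ = 1) :
    floquet L U V * (floquet L U V)ᴴ = 1 := by
  have hT : translation d L * (translation d L)ᵀ = 1 := translation_mul_transpose d L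
  have hT' : (translation d L)ᵀ * translation d L = 1 := mul_eq_one_comm.1 hT
  have hTc : (translation d L)ᴴ = (translation d L)ᵀ := by
    ext σ τ
    simp [translation, apply_ite]
  have hTt : (translation d L)ᵀᴴ = translation d L := by
    rw [← hTc, conjTranspose_conjTranspose]
  simp only [floquet, translation_inv, conjTranspose_mul, hTc, hTt]
  calc _ = translation d L * (gateLayer L V * ((translation d L)ᵀ *
        (gateLayer L U * (gateLayer L U)ᴴ) * translation d L) * (gateLayer L V)ᴴ) *
        (translation d L)ᵀ := by simp only [Matrix.mul_assoc]
    _ = 1 := by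
      rw [gateLayer_mul_conjTranspose hU, mul_one, hT', mul_one, gateLayer_mul_conjTranspose hV,
        mul_one, hT]

/-! ### Stretched operators: growth and orthogonality. -/

/-- The operator `a` acts trivially outside of the sites `x, x + 1, …, x + m` and its partial
traces over `x` and over `x + m` vanish. -/
structure IsStretched (x : ZMod (2 * L)) (m : ℕ) (a : Op d (ZMod (2 * L))) : Prop where
  trivialAt : ∀ j, (∀ i ≤ m, j ≠ x + (i : ℕ)) → TrivialAt j a
  left : TracelessAt x a
  right : TracelessAt (x + (m : ℕ)) a

theorem add_ne_add {L : ℕ} {x : ZMod (2 * L)} {i j : ℕ} (hi : i < 2 * L) (hj : j < 2 * L) (h : i ≠ j) :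
    x + (i : ℕ) ≠ x + (j : ℕ) := by
  intro e
  exact h ((site_eq_iff hi hj).1 (add_left_cancel e))

/-- A layer of dual-unitary gates lets both edges grow if they sit on the inner legs of gates. -/
theorem IsStretched.conj {c : ZMod (2 * L)} {U : Gate d} {G a : Op d (ZMod (2 * L))}
    (hG : IsLayer c U G) (hU : IsDualUnitary U) {x : ZMod (2 * L)} {m : ℕ}
    (ha : IsStretched x m a) (hx : Even (x - 1 + c)) (hm : Odd m) (hmL : m + 3 ≤ 2 * L) :
    IsStretched (x - 1) (m + 2) (G * a * Gᴴ) := by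
  have hL : 0 < L := NeZero.pos L
  have hxs : x - 1 + 1 = x := by ring
  have hleft : ∀ i ≤ m, x - 1 ≠ x + (i : ℕ) := by
    intro i hi
    have := add_ne_add (x := x - 1) (i := 0) (j := i + 1) (by omega) (by omega) (by omega)
    have h1 : x - 1 + ((i + 1 : ℕ) : ZMod (2 * L)) = x + (i : ℕ) := by push_cast; ring
    rwa [h1, Nat.cast_zero, add_zero] at this
  have hright : ∀ i ≤ m, x + (m : ℕ) + 1 ≠ x + (i : ℕ) := by
    intro i hi
    have := add_ne_add (x := x) (i := m + 1) (j := i) (by omega) (by omega) (by omega)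
    rwa [Nat.cast_succ, ← add_assoc] at this
  refine ⟨?_, ?_, ?_⟩
  -- A site outside the enlarged interval has its gate partner outside the old one, so the whole
  -- gate acts on a trivial pair.
  · intro j hj
    have h0 : ∀ i ≤ m, j ≠ x + (i : ℕ) := by
      intro i hi e
      refine hj (i + 1) (by omega) ?_
      rw [e]; push_cast; ring
    have h1 : ∀ i ≤ m, j + 1 ≠ x + (i : ℕ) := by
      intro i hi e
      refine hj i (by omega) ?_
      rw [eq_sub_of_add_eq e]; ring
    have h2 : ∀ i ≤ m, j - 1 ≠ x + (i : ℕ) := by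
      intro i hi e
      refine hj (i + 2) (by omega) ?_
      rw [eq_add_of_sub_eq e]; push_cast; ring
    rcases even_or_even_sub_one (j + c) with he | he
    · exact (hG j he).trivialAt_left hU (ha.trivialAt _ h0) (ha.trivialAt _ h1)
    · have he' : Even (j - 1 + c) := by convert he using 1; ring
      have h3 : j - 1 + 1 = j := by ring
      have := (hG (j - 1) he').trivialAt_right (a := a) hU (ha.trivialAt _ h2)
        (ha.trivialAt _ (by rwa [h3]))
      rwa [h3] at this
  · exact (hG (x - 1) hx).tracelessAt_left hU (ha.trivialAt _ hleft) (by rw [hxs]; exact ha.left)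
  -- Odd `m` puts the right end on the left leg of a gate whenever the left end is on a right leg.
  · have he : Even (x + (m : ℕ) + c) := by
      have : x + (m : ZMod (2 * L)) + c = x - 1 + c + ((m + 1 : ℕ) : ZMod (2 * L)) := by
        push_cast; ring
      rw [this]
      exact hx.add hm.add_one.natCast
    have := (hG _ he).tracelessAt_right (a := a) hU (ha.trivialAt _ hright) ha.right
    convert this using 1
    push_cast; ring

theorem IsStretched.conj_conj {c c' : ZMod (2 * L)} {U V : Gate d} {G H a : Op d (ZMod (2 * L))}
    (hG : IsLayer c U G) (hU : IsDualUnitary U) (hH : IsLayer c' V H) (hV : IsDualUnitary V)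
    {x : ZMod (2 * L)} {m : ℕ} (ha : IsStretched x m a) (hx : Even (x - 1 + c))
    (hx' : Even (x - 1 - 1 + c')) (hm : Odd m) (hmL : m + 5 ≤ 2 * L) :
    IsStretched (x - 1 - 1) (m + 4) (H * (G * a * Gᴴ) * Hᴴ) :=
  (ha.conj hG hU hx hm (by omega)).conj hH hV hx' (hm.add_even even_two) (by omega)

/-- Stretched operators on different intervals are orthogonal. -/
theorem IsStretched.trace_eq_zero {x x' : ZMod (2 * L)} {m m' : ℕ} {a b : Op d (ZMod (2 * L))}
    (ha : IsStretched x m a) (hb : IsStretched x' m' b) (hne : ¬(x = x' ∧ m = m'))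
    (hm : m + m' + 2 ≤ 2 * L) : trace (aᴴ * b) = 0 := by
  have hsymm : trace (bᴴ * a) = 0 → trace (aᴴ * b) = 0 := by
    intro h
    have := congrArg star h
    rwa [← trace_conjTranspose, conjTranspose_mul, conjTranspose_conjTranspose, star_zero] at this
  -- Measure positions from `x`: the intervals are `[0, m]` and `[t, t + m']`. The bound on `m + m'`
  -- rules out wrap-around once `t ≤ m`, so some end of one interval lies outside the other.
  have hx : x' = x + ((x' - x).val : ℕ) := by rw [ZMod.natCast_zmod_val]; ring
  have ht := ZMod.val_lt (x' - x)
  generalize (x' - x).val = t at hx ht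
  subst hx
  by_cases h1 : m < t
  · exact trace_conjTranspose_mul_eq_zero
      (ha.trivialAt _ fun i hi => add_ne_add ht (by omega) (by omega)) hb.left
  by_cases h2 : m < t + m'
  · refine trace_conjTranspose_mul_eq_zero (ha.trivialAt _ fun i hi => ?_) hb.right
    have := add_ne_add (x := x) (i := t + m') (j := i) (by omega) (by omega) (by omega)
    rwa [Nat.cast_add, ← add_assoc] at this
  apply hsymm
  by_cases h3 : t = 0
  · subst h3
    have h4 : m' < m := by
      rcases lt_or_eq_of_le (show m' ≤ m by omega) with h | h
      · exact h
      · exact absurd ⟨by simp, h.symm⟩ hne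
    refine trace_conjTranspose_mul_eq_zero (hb.trivialAt _ fun i hi => ?_) ha.right
    have := add_ne_add (x := x) (i := m) (j := i) (by omega) (by omega) (by omega)
    simpa using this
  · refine trace_conjTranspose_mul_eq_zero (hb.trivialAt _ fun i hi => ?_) ha.left
    have := add_ne_add (x := x) (i := 0) (j := t + i) (by omega) (by omega) (by omega)
    rw [Nat.cast_add, ← add_assoc] at this
    simpa using this

theorem place_apply_of_mem {w : ℕ} {x : ZMod (2 * L)} {a : Op d (Fin w)} {σ τ}
    (h : ∀ y : ZMod (2 * L), (∀ i : Fin w, y ≠ x + (i.val : ZMod (2 * L))) → σ y = τ y) :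
    place x a σ τ = a (fun i => σ (x + (i.val : ZMod (2 * L))))
      (fun i => τ (x + (i.val : ZMod (2 * L)))) := by
  simp only [place, of_apply]
  rw [if_pos h]

theorem tracelessAt_place {w : ℕ} (hw : w ≤ 2 * L) (x : ZMod (2 * L)) {a : Op d (Fin w)}
    (i : Fin w) (ha : partialTrace i a = 0) : TracelessAt (x + (i.val : ZMod (2 * L))) (place x a) := by
  intro σ τ
  have hinj : ∀ j : Fin w, x + (j.val : ZMod (2 * L)) = x + (i.val : ZMod (2 * L)) ↔ j = i := by
    intro j
    constructor
    · intro e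
      by_contra hne
      exact add_ne_add (by omega) (by omega) (fun h => hne (Fin.ext h)) e
    · rintro rfl; rfl
  have hupd : ∀ (ρ : ZMod (2 * L) → Fin d) c, (fun j : Fin w =>
      update ρ (x + (i.val : ZMod (2 * L))) c (x + (j.val : ZMod (2 * L)))) =
      (Equiv.funSplitAt i (Fin d)).symm (c, fun j => ρ (x + (j.val.val : ZMod (2 * L)))) := by
    intro ρ c
    funext j
    simp only [update_apply, hinj]
    by_cases h : j = i
    · subst h; simp [Equiv.funSplitAt, Equiv.piSplitAt]
    · simp [Equiv.funSplitAt, Equiv.piSplitAt, h]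
  by_cases h : ∀ y : ZMod (2 * L), (∀ j : Fin w, y ≠ x + (j.val : ZMod (2 * L))) → σ y = τ y
  · have h' : ∀ c, ∀ y : ZMod (2 * L), (∀ j : Fin w, y ≠ x + (j.val : ZMod (2 * L))) →
        update σ (x + (i.val : ZMod (2 * L))) c y = update τ (x + (i.val : ZMod (2 * L))) c y := by
      intro c y hy
      rw [update_of_ne (hy i), update_of_ne (hy i), h y hy]
    simp only [fun c => place_apply_of_mem (a := a) (h' c), hupd]
    have := congrFun (congrFun ha fun j => σ (x + (j.val.val : ZMod (2 * L))))
      fun j => τ (x + (j.val.val : ZMod (2 * L)))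
    simpa [partialTrace] using this
  · refine Finset.sum_eq_zero fun c _ => ?_
    simp only [place, of_apply]
    rw [if_neg]
    intro h'
    apply h
    intro y hy
    have := h' y hy
    rwa [update_of_ne (hy i), update_of_ne (hy i)] at this

theorem isStretched_place {m : ℕ} (hm : m + 1 ≤ 2 * L) (x : ZMod (2 * L))
    {a : Op d (Fin (m + 1))} (ha : a ∈ boundaryTraceless d (m + 1)) :
    IsStretched x m (place x a) := by
  refine ⟨?_, ?_, ?_⟩
  · intro j hj σ τ
    have hj' : ∀ i : Fin (m + 1), j ≠ x + (i.val : ZMod (2 * L)) := fun i => hj i.val (by omega)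
    constructor
    · intro hne
      simp only [place, of_apply]
      exact if_neg fun h => hne (h j hj')
    · intro he c
      simp only [place, of_apply]
      have h1 : ∀ (ρ : ZMod (2 * L) → Fin d) (i : Fin (m + 1)),
          update ρ j c (x + (i.val : ZMod (2 * L))) = ρ (x + (i.val : ZMod (2 * L))) :=
        fun ρ i => update_of_ne (hj' i).symm _ _
      simp only [h1]
      congr 1
      refine propext (forall₂_congr fun y _ => ?_)
      by_cases hy : y = j
      · subst hy; simp [he]
      · simp [hy]
  · have := tracelessAt_place hm x (0 : Fin (m + 1)) (ha 0 (Or.inl rfl))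
    simpa using this
  · exact tracelessAt_place hm x (Fin.last m) (ha _ (Or.inr (by simp)))

theorem eq_zero_of_place_eq_zero {w : ℕ} (hw1 : 1 ≤ w) (hw : w ≤ 2 * L) {x : ZMod (2 * L)}
    {a : Op d (Fin w)} (h : place x a = 0) : a = 0 := by
  ext s t
  -- Both configurations are extended by the same value off the interval. The choice `s 0` uses `1 ≤
  -- w` and supplies an element of `Fin d` without assuming `d` positive.
  let ext : (Fin w → Fin d) → ZMod (2 * L) → Fin d := fun u y =>
    if hy : (y - x).val < w then u ⟨(y - x).val, hy⟩ else s ⟨0, hw1⟩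
  have hext : ∀ u, (fun i : Fin w => ext u (x + (i.val : ZMod (2 * L)))) = u := by
    intro u
    funext i
    have : (x + (i.val : ZMod (2 * L)) - x).val = i.val := by
      rw [add_sub_cancel_left]
      exact ZMod.val_natCast_of_lt (by omega)
    simp only [ext, this, i.2, dif_pos]
  have key := congrFun (congrFun h (ext s)) (ext t)
  rw [place_apply_of_mem, hext, hext] at key
  · exact key
  · intro y hy
    have : ¬ (y - x).val < w := by
      intro hlt
      refine hy ⟨_, hlt⟩ ?_
      simp
    simp only [ext, this, dif_neg, not_false_eq_true]

end Ring

open scoped ComplexOrder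

/-! ### Overlaps of a conserved charge with stretched operators. -/

section Charge

variable {d L : ℕ} [NeZero L] {q : ZMod (2 * L) → (w : ℕ) → Op d (Fin w)}

theorem isStretched_term (hq : ∀ x, ∀ w ∈ Finset.Icc 1 (L - 4), q x w ∈ boundaryTraceless d w)
    (x : ZMod (2 * L)) {m : ℕ} (hm : m + 1 ≤ L - 4) : IsStretched x m (place x (q x (m + 1))) :=
  isStretched_place (by omega) x (hq x (m + 1) (by simp [hm]))

theorem trace_charge_mul (b : Op d (ZMod (2 * L))) :
    trace ((charge q)ᴴ * b) = ∑ x, ∑ w ∈ Finset.Icc 1 (L - 4), trace ((place x (q x w))ᴴ * b) := by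
  simp only [charge, conjTranspose_sum, Finset.sum_mul, trace_sum]

/-- A charge is orthogonal to the operators which are stretched too far. -/
theorem trace_charge_mul_eq_zero
    (hq : ∀ x, ∀ w ∈ Finset.Icc 1 (L - 4), q x w ∈ boundaryTraceless d w)
    {x : ZMod (2 * L)} {m : ℕ} {a : Op d (ZMod (2 * L))} (ha : IsStretched x m a)
    (hm : m + 1 ≤ L) (hm' : L - 4 < m + 1) : trace ((charge q)ᴴ * a) = 0 := by
  rw [trace_charge_mul]
  refine Finset.sum_eq_zero fun y _ => Finset.sum_eq_zero fun w hw => ?_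
  obtain ⟨hw1, hw2⟩ := Finset.mem_Icc.1 hw
  obtain ⟨n, rfl⟩ : ∃ n, w = n + 1 := ⟨w - 1, by omega⟩
  exact (isStretched_term hq y hw2).trace_eq_zero ha (by omega) (by omega)

theorem trace_charge_mul_term
    (hq : ∀ x, ∀ w ∈ Finset.Icc 1 (L - 4), q x w ∈ boundaryTraceless d w)
    (x : ZMod (2 * L)) {w : ℕ} (hw : w ∈ Finset.Icc 1 (L - 4)) :
    trace ((charge q)ᴴ * place x (q x w)) = trace ((place x (q x w))ᴴ * place x (q x w)) := by
  have key : ∀ y, ∀ v ∈ Finset.Icc 1 (L - 4), ¬(y = x ∧ v = w) →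
      trace ((place y (q y v))ᴴ * place x (q x w)) = 0 := by
    intro y v hv hne
    obtain ⟨hv1, hv2⟩ := Finset.mem_Icc.1 hv
    obtain ⟨hw1, hw2⟩ := Finset.mem_Icc.1 hw
    obtain ⟨n, rfl⟩ : ∃ n, v = n + 1 := ⟨v - 1, by omega⟩
    obtain ⟨m, rfl⟩ : ∃ m, w = m + 1 := ⟨w - 1, by omega⟩
    exact (isStretched_term hq y hv2).trace_eq_zero (isStretched_term hq x hw2)
      (fun e => hne ⟨e.1, by rw [e.2]⟩) (by omega)
  rw [trace_charge_mul, Finset.sum_eq_single x, Finset.sum_eq_single w]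
  · exact fun v hv hne => key x v hv fun e => hne e.2
  · exact fun h => absurd hw h
  · exact fun y _ hne => Finset.sum_eq_zero fun v hv => key y v hv fun e => hne e.1
  · exact fun h => absurd (Finset.mem_univ _) h

/-- By orthogonality of the terms the overlap is the squared Hilbert–Schmidt norm of the term
itself. -/
theorem place_eq_zero_of_trace
    (hq : ∀ x, ∀ w ∈ Finset.Icc 1 (L - 4), q x w ∈ boundaryTraceless d w)
    {x : ZMod (2 * L)} {w : ℕ} (hw : w ∈ Finset.Icc 1 (L - 4))
    (h : trace ((charge q)ᴴ * place x (q x w)) = 0) : place x (q x w) = 0 := by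
  rw [trace_charge_mul_term hq x hw] at h
  exact trace_conjTranspose_mul_self_eq_zero_iff.1 h

/-- A charge invariant under `W` is orthogonal to every family of operators that `W` keeps
stretching. -/
theorem trace_charge_mul_eq_zero_of_stretching
    (hq : ∀ x, ∀ w ∈ Finset.Icc 1 (L - 4), q x w ∈ boundaryTraceless d w)
    {W : Op d (ZMod (2 * L))} (hW : W * Wᴴ = 1) (hQ : W * charge q * Wᴴ = charge q)
    {c : ZMod (2 * L)} (hstep : ∀ x m a, IsStretched x m a → Even (x - 1 + c) → Odd m →
      m + 5 ≤ 2 * L → IsStretched (x - 1 - 1) (m + 4) (W * a * Wᴴ)) (n : ℕ) :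
    ∀ x m a, IsStretched x m a → Even (x - 1 + c) → Odd m → m + 1 ≤ L → L - m ≤ n →
      trace ((charge q)ᴴ * a) = 0 := by
  induction n with
  | zero => intro x m a _ _ _ h1 h2; omega
  | succ n ih =>
    intro x m a ha hx hm hmL hn
    -- Otherwise the width is at most `L - 4`, and one more step keeps it at most `L`.
    by_cases hlt : L - 4 < m + 1
    · exact trace_charge_mul_eq_zero hq ha hmL hlt
    have hW' : Wᴴ * W = 1 := mul_eq_one_comm.1 hW
    have hinv : trace ((charge q)ᴴ * (W * a * Wᴴ)) = trace ((charge q)ᴴ * a) := by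
      conv_lhs => rw [← hQ]
      simp only [conjTranspose_mul, conjTranspose_conjTranspose]
      calc _ = trace (W * ((charge q)ᴴ * (Wᴴ * W) * a * Wᴴ)) := by simp only [Matrix.mul_assoc]
        _ = trace ((charge q)ᴴ * a * (Wᴴ * W)) := by
          rw [trace_mul_comm, hW', mul_one, Matrix.mul_assoc, hW']
        _ = _ := by rw [hW', mul_one]
    rw [← hinv]
    refine ih _ _ _ (hstep x m a ha hx hm (by omega)) ?_ (hm.add_even (by decide)) (by omega)
      (by omega)
    have : x - 1 - 1 - 1 + c = x - 1 + c - 2 := by ring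
    rw [this]
    exact hx.sub even_two

variable {U V : Gate d}

/-- A conserved charge has no overlap with stretched operators of even width. -/
theorem trace_charge_mul_eq_zero_of_isConserved (hU : IsDualUnitary U) (hV : IsDualUnitary V)
    (hq : ∀ x, ∀ w ∈ Finset.Icc 1 (L - 4), q x w ∈ boundaryTraceless d w)
    (hQ : IsConserved U V (charge q)) {x : ZMod (2 * L)} {m : ℕ} {a : Op d (ZMod (2 * L))}
    (ha : IsStretched x m a) (hm : Odd m) (hmL : m + 1 ≤ L) :
    trace ((charge q)ᴴ * a) = 0 := by
  have hF : floquet L U V * (floquet L U V)ᴴ = 1 :=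
    floquet_mul_conjTranspose (mem_unitaryGroup_iff.1 hU.1) (mem_unitaryGroup_iff.1 hV.1)
  have hF' : (floquet L U V)ᴴ * floquet L U V = 1 := mul_eq_one_comm.1 hF
  -- For even `x` the ends are inner legs of the `V` layer, which acts first in the inverse
  -- evolution; for odd `x` they are inner legs of the `U` layer, which acts first in the forward
  -- one.
  rcases even_or_even_sub_one x with hx | hx
  · refine trace_charge_mul_eq_zero_of_stretching (W := (floquet L U V)ᴴ) (c := 1) hq ?_ ?_ ?_ _
      x m a ha (by simpa using hx) hm hmL le_rfl
    · rwa [conjTranspose_conjTranspose]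
    · rw [conjTranspose_conjTranspose]
      conv_lhs => rw [← hQ]
      calc _ = ((floquet L U V)ᴴ * floquet L U V) * charge q *
            ((floquet L U V)ᴴ * floquet L U V) := by simp only [Matrix.mul_assoc]
        _ = _ := by rw [hF', one_mul, mul_one]
    · intro x m a ha hx hm hmL
      have hx' : Even (x - 1 - 1 + 0) := by
        have h : x - 1 - 1 + 0 = x - 1 + 1 - 2 := by ring
        rw [h]
        exact hx.sub even_two
      have := ha.conj_conj (isLayer_translation_conj V).conjTranspose hV.conjTranspose
        (isLayer_gateLayer U).conjTranspose hU.conjTranspose hx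
        hx' hm hmL
      convert this using 1
      simp only [floquet, conjTranspose_mul, conjTranspose_conjTranspose, Matrix.mul_assoc]
  · refine trace_charge_mul_eq_zero_of_stretching (W := floquet L U V) (c := 0) hq hF hQ ?_ _
      x m a ha (by simpa using hx) hm hmL le_rfl
    intro x m a ha hx hm hmL
    have := ha.conj_conj (isLayer_gateLayer U) hU (isLayer_translation_conj V) hV hx
      (by simpa using hx) hm hmL
    convert this using 1
    simp only [floquet, conjTranspose_mul, Matrix.mul_assoc]

theorem trace_charge_mul_place_eq_zero (hU : IsDualUnitary U) (hV : IsDualUnitary V)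
    (hq : ∀ x, ∀ w ∈ Finset.Icc 1 (L - 4), q x w ∈ boundaryTraceless d w)
    (hQ : IsConserved U V (charge q)) (x : ZMod (2 * L)) {w : ℕ} {a : Op d (Fin w)}
    (ha : a ∈ boundaryTraceless d w) (hw : Even w) (hw1 : 1 ≤ w) (hwL : w ≤ L) :
    trace ((charge q)ᴴ * place x a) = 0 := by
  obtain ⟨m, rfl⟩ : ∃ m, w = m + 1 := ⟨w - 1, by omega⟩
  exact trace_charge_mul_eq_zero_of_isConserved hU hV hq hQ (isStretched_place (by omega) x ha)
    (by grind) hwL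

end Charge

end DUC

/-! ### The three claims. -/

theorem lemma3 (d L : ℕ) [NeZero L] (U V : DUC.Gate d)
    (hU : DUC.IsDualUnitary U) (hV : DUC.IsDualUnitary V)
    (q : ZMod (2 * L) → (w : ℕ) → DUC.Op d (Fin w))
    (hq : ∀ x, ∀ w ∈ Finset.Icc 1 (L - 4), q x w ∈ DUC.boundaryTraceless d w) :
    (DUC.IsConserved U V (DUC.charge q) →
      ∀ a ∈ DUC.evenEven d L, Matrix.trace ((DUC.charge q).conjTranspose * a) = 0) ∧
    (DUC.charge q ≠ 0 → DUC.termsOf (DUC.charge q) ⊆ DUC.oddEven d L →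
      ¬ DUC.IsConserved U V (DUC.charge q)) ∧
    (DUC.IsConserved U V (DUC.charge q) →
      ∀ x, ∀ w ∈ Finset.Icc 1 (L - 4), Even w → q x w = 0) := by
  refine ⟨?_, ?_, ?_⟩
  · rintro hQ _ ⟨x, w, a, -, hw, hw1, hwL, ha, rfl⟩
    exact DUC.trace_charge_mul_place_eq_zero hU hV hq hQ x ha hw hw1 hwL
  · intro hne hsub hQ
    refine hne (Finset.sum_eq_zero fun x _ => Finset.sum_eq_zero fun w hw => ?_)
    refine DUC.place_eq_zero_of_trace hq hw ?_
    by_contra h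
    -- The inclusion only says that the term equals some odd-even operator, possibly presented with
    -- other `x'` and `w'`. This suffices, since the overlap depends on the operator alone.
    obtain ⟨x', w', a, -, hw', hw1, hwL, ha, he⟩ := hsub ⟨x, w, q x w, hw, hq x w hw, rfl, h⟩
    rw [he] at h
    exact h (DUC.trace_charge_mul_place_eq_zero hU hV hq hQ x' ha hw' hw1 hwL)
  · intro hQ x w hw heven
    obtain ⟨hw1, hw2⟩ := Finset.mem_Icc.1 hw
    exact DUC.eq_zero_of_place_eq_zero hw1 (by omega) (DUC.place_eq_zero_of_trace hq hw
      (DUC.trace_charge_mul_place_eq_zero hU hV hq hQ x (hq x w hw) heven hw1 (by omega)))
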